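/- **Theorem 3.11.** Let $R$ be a commutative ring and let $A$ be a (not necessarily commutative) associative unital $R$-algebra that is free of rank $n$ as an $R$-module, with $R$-basis $\beta=(e_1,\dots,e_n)$. Then $$\operatorname{disc}(A,\beta)\equiv \operatorname{dpf}(A',\beta')^2 \pmod{4R},$$ where $A'=R\times A$ is the product algebra, with the $R$-basis $\beta'=((1,1),(0,e_1),\dots,(0,e_n))$, whose first element is $1_{A'}$. Here, for an $R$-algebra $C$ with a finite $R$-basis $\gamma=(f_1,\dots,f_m)$, the Gram matrix $B(C,\gamma)=(b_{ij})\in M_m(R)$ has the entries $b_{ij}=\operatorname{Tr}(\lambda_\gamma(f_if_j))$, where $\lambda_\gamma(c)$ is the matrix in the basis $\gamma$ of left multiplication by $c$ on $C$, and $\operatorname{disc}(C,\gamma)=\det B(C,\gamma)$. If moreover $f_1=1$, the discriminant pfaffian of $(C,\gamma)$ is $$\operatorname{dpf}(C,\gamma)=\sum_{\substack{J\subseteq\{2,\dots,m\}\\ \#J\text{ even}}}\ \sum_{P}\Bigl(\prod_{\{i,j\}\in P}b_{ij}\Bigr)\Bigl(\prod_{k\in\{2,\dots,m\}\smallsetminus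 J}b_{1k}\Bigr),$$ where $P$ runs over the perfect matchings on $J$, i.e. the partitions of $J$ into subsets of cardinality $2$, and empty products equal $1$. -/

import Mathlib

namespace DiscPfaffian

open Module

/-- The trace pairing `t_β(a, b) = Tr(λ_β(a b))`, where `λ_β(a)` is the matrix of left
multiplication by `a` in the basis `β` of the (not necessarily commutative) `R`-algebra `A`. -/
noncomputable def tracePairing {R A : Type*} [CommRing R] [Ring A] [Algebra R A] {n : ℕ}
    (β : Basis (Fin n) R A) (a b : A) : R :=
  (Algebra.leftMulMatrix β (a * b)).trace

/-- The Gram matrix `B(A, β) = (t_β(e_i, e_j))_{i,j}` of a framed algebra. -/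
noncomputable def gram {R A : Type*} [CommRing R] [Ring A] [Algebra R A] {n : ℕ}
    (β : Basis (Fin n) R A) : Matrix (Fin n) (Fin n) R :=
  Matrix.of fun i j => tracePairing β (β i) (β j)

/-- The discriminant `disc(A, β) = det B(A, β)`. -/
noncomputable def disc {R A : Type*} [CommRing R] [Ring A] [Algebra R A] {n : ℕ}
    (β : Basis (Fin n) R A) : R :=
  (gram β).det

/-- The perfect matchings on `J`: the partitions of `J` into subsets of cardinality `2`. -/
def perfectMatchings {m : ℕ} (J : Finset (Fin m)) : Finset (Finpartition J) :=
  Finset.univ.filter fun P => ∀ p ∈ P.parts, p.card = 2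

/-- The discriminant pfaffian of a (symmetric) matrix `B`, whose distinguished first index is `0`:
the sum over the subsets `J` of even cardinality of the set of the other indices, and over the
perfect matchings `P` on `J`, of `∏_{ {i,j} ∈ P } b_{ij}` times `∏_{k ∉ J, k ≠ 0} b_{0k}`.
For a part `p = {i, j}` of `P` with `i < j`, the inner product below has the single factor
`b_{ij}`. -/
def matrixDpf {R : Type*} [CommRing R] {m : ℕ} (B : Matrix (Fin (m + 1)) (Fin (m + 1)) R) : R :=
  ∑ J ∈ (Finset.univ.erase (0 : Fin (m + 1))).powerset with Even J.card,
    ∑ P ∈ perfectMatchings J,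
      (∏ p ∈ P.parts, ∏ x ∈ p.offDiag with x.1 < x.2, B x.1 x.2) *
        ∏ k ∈ Finset.univ.erase (0 : Fin (m + 1)) \ J, B 0 k

/-- The discriminant pfaffian `dpf(A, β) = dpf(B(A, β))` of an algebra with a unital basis `β`
(that is, `β 0 = 1`). -/
noncomputable def dpf {R A : Type*} [CommRing R] [Ring A] [Algebra R A] {m : ℕ}
    (β : Basis (Fin (m + 1)) R A) : R :=
  matrixDpf (gram β)

/-- The coordinates on `R × A` with respect to `(1,1), (0,e_1), …, (0,e_n)`: the element `(r, a)`
has first coordinate `r`, and the others are those of `a - r • 1`. -/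
noncomputable def unitalCoords {R A : Type*} [CommRing R] [Ring A] [Algebra R A] {n : ℕ}
    (β : Basis (Fin n) R A) : (R × A) ≃ₗ[R] (Fin (n + 1) → R) where
  toFun x := Fin.cons x.1 (β.equivFun (x.2 - x.1 • (1 : A)))
  invFun c := (c 0, β.equivFun.symm (Fin.tail c) + c 0 • (1 : A))
  map_add' x y := by
    ext i
    refine Fin.cases ?_ (fun i => ?_) i
    · simp
    · simp [add_smul]
      ring
  map_smul' r x := by
    ext i
    refine Fin.cases ?_ (fun i => ?_) i
    · simp
    · simp [mul_smul]
      ring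
  left_inv x := by
    ext
    · simp
    · simp only [Fin.cons_zero, Fin.tail_cons, LinearEquiv.symm_apply_apply, sub_add_cancel]
  right_inv c := by
    ext i
    refine Fin.cases ?_ (fun i => ?_) i
    · simp
    · simp only [add_sub_cancel_right, LinearEquiv.apply_symm_apply, Fin.cons_succ, Fin.tail]

/-- The framing `β' = ((1,1), (0,e_1), …, (0,e_n))` of `A' = R × A`. -/
noncomputable def unitalFraming {R A : Type*} [CommRing R] [Ring A] [Algebra R A] {n : ℕ}
    (β : Basis (Fin n) R A) : Basis (Fin (n + 1)) R (R × A) :=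
  Basis.ofEquivFun (unitalCoords β)

theorem coe_unitalFraming {R A : Type*} [CommRing R] [Ring A] [Algebra R A] {n : ℕ}
    (β : Basis (Fin n) R A) :
    (unitalFraming β : Fin (n + 1) → R × A) =
      Fin.cons ((1, 1) : R × A) fun i => ((0, β i) : R × A) := by
  funext i
  rw [unitalFraming, Basis.coe_ofEquivFun, LinearEquiv.symm_apply_eq]
  refine Fin.cases ?_ (fun i => ?_) i
  · ext j
    refine Fin.cases ?_ (fun j => ?_) j <;> simp [unitalCoords]
  · ext j
    refine Fin.cases ?_ (fun j => ?_) j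
    · simp [unitalCoords]
    · simp [unitalCoords, Finsupp.single_apply, Pi.single_apply, eq_comm]

/-- The framing `β'` is unital. -/
theorem unitalFraming_zero {R A : Type*} [CommRing R] [Ring A] [Algebra R A] {n : ℕ}
    (β : Basis (Fin n) R A) : unitalFraming β 0 = 1 := by
  rw [coe_unitalFraming]
  rfl

end DiscPfaffian

/-! Let `B` be the Gram matrix of `A`, `t` the vector of traces of the basis and `c` the coordinates
of `1`. Then `B c = t`, `t ⬝ c = n`, and `B i i ≡ t i ^ 2` mod 2, so `t tᵀ - B = L + Lᵀ` for some
`L`; the Gram matrix of `R × A` is `B` bordered by `t`. Put `K = Lᵀ - L`.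

For `n` even, expanding `det (K + 2 L)` to first order gives `det (L + Lᵀ) ≡ (1 - n) det K` mod 4,
while the rank one update gives `det (L + Lᵀ) = (1 - n) det B`. As `1 - n` is odd, `det B ≡ det K`
mod 4 (`four_dvd_det_sub_det_antisymm`).

It remains to compare `det K` with `dpf ^ 2`. Over a polynomial ring over `ℤ`, `det K = q ^ 2`. Mod
2, `q ^ 2 = det (K + t tᵀ) = det B = dpf ^ 2`, the last equality because only involutions survive in
the determinant (`matrixDpf_sq`). Polynomials over `ZMod 2` are reduced, so `dpf = q + 2 r` and `dpf
^ 2 ≡ q ^ 2` mod 4; this specialises to `R`.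

For `n` odd, `B` is replaced by the direct sum of `1` and `B`, which has even size and the same
determinant. -/

namespace DiscPfaffian

open Matrix

/-! ### Determinants of `L + Lᵀ` and `Lᵀ - L` modulo 4. -/

section DetExpansion

variable {R ι : Type*} [CommRing R] [Fintype ι] [DecidableEq ι]

theorem dvd_det_sub_det {r : R} {M N : Matrix ι ι R} (h : ∀ i j, r ∣ M i j - N i j) :
    r ∣ M.det - N.det := by
  rw [← Ideal.Quotient.eq_zero_iff_dvd, map_sub, sub_eq_zero, RingHom.map_det, RingHom.map_det]
  congr 1
  ext i j
  simpa [sub_eq_zero] using (Ideal.Quotient.eq_zero_iff_dvd r _).2 (h i j)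

/-- First order expansion of the determinant. -/
theorem sq_dvd_det_add_smul_sub (X Y : Matrix ι ι R) (r : R) :
    r ^ 2 ∣ (X + r • Y).det - (X.det + r * (X.adjugate * Y).trace) := by
  -- The perturbation is switched on one row at a time.
  have key : ∀ s : Finset ι, r ^ 2 ∣ (Matrix.of fun i => if i ∈ s then X i + r • Y i else X i).det -
      (X.det + r * ∑ i ∈ s, (X.updateRow i (Y i)).det) := by
    intro s
    induction s using Finset.induction_on with
    | empty => simp [show (Matrix.of fun i => X i) = X from rfl]
    | insert a s ha ih =>
      set M : Matrix ι ι R := Matrix.of fun i => if i ∈ s then X i + r • Y i else X i with hM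
      have e : (Matrix.of fun i => if i ∈ insert a s then X i + r • Y i else X i) =
          M.updateRow a (M a + r • Y a) := by
        ext i j
        by_cases hi : i = a
        · subst hi; simp [hM, ha]
        · simp [hM, hi]
      -- This determinant enters with a factor `r`, so knowing it mod `r` suffices.
      have h1 : r ∣ (M.updateRow a (Y a)).det - (X.updateRow a (Y a)).det := by
        refine dvd_det_sub_det fun i j => ?_
        by_cases hi : i = a
        · subst hi; simp
        · by_cases his : i ∈ s <;> simp [hM, hi, his]
      obtain ⟨u, hu⟩ := h1
      obtain ⟨v, hv⟩ := ih
      rw [e, det_updateRow_add, det_updateRow_smul, updateRow_eq_self, Finset.sum_insert ha]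
      refine ⟨u + v, ?_⟩
      linear_combination hv + r * hu
  convert key Finset.univ using 3
  · ext i j
    simp
  · simp only [← cramer_transpose_apply, cramer_eq_adjugate_mulVec]
    simp only [trace, diag, mul_apply, mulVec, dotProduct, ← adjugate_transpose, transpose_apply]
    rw [Finset.sum_comm]

/-- The adjugate is homogeneous of degree `card ι - 1`, which is odd. -/
theorem adjugate_transpose_of_antisymm (hm : Even (Fintype.card ι)) {K : Matrix ι ι R}
    (hK : Kᵀ = -K) : K.adjugateᵀ = -K.adjugate := by
  rcases isEmpty_or_nonempty ι with h | h
  · ext i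
    exact h.elim i
  rw [adjugate_transpose, hK, ← neg_one_smul R K, adjugate_smul, Odd.neg_one_pow, neg_one_smul]
  have := Fintype.card_pos (α := ι)
  exact Nat.Even.sub_odd this hm odd_one

/-- With `K = Lᵀ - L`, expand `det (K + 2 L)`. The linear term is `2 tr (adj K * L)`; antisymmetry
of `adj K` identifies it with `-tr (adj K * K) = -card ι * det K`. -/
theorem four_dvd_det_symm_sub (hm : Even (Fintype.card ι)) (L : Matrix ι ι R) :
    (4 : R) ∣ (L + Lᵀ).det - (1 - Fintype.card ι) * (Lᵀ - L).det := by
  set K := Lᵀ - L with hK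
  have hKt : Kᵀ = -K := by simp [hK]
  have h1 := sq_dvd_det_add_smul_sub K L 2
  have e : K + (2 : R) • L = L + Lᵀ := by
    rw [hK, two_smul]; abel
  have h2 : (K.adjugate * Lᵀ).trace = -(K.adjugate * L).trace := by
    rw [← trace_transpose, transpose_mul, transpose_transpose,
      adjugate_transpose_of_antisymm hm hKt, trace_mul_comm, neg_mul, trace_neg]
  have h3 : (K.adjugate * K).trace = Fintype.card ι * K.det := by
    rw [adjugate_mul]
    simp [mul_comm]
  have h4 : (K.adjugate * K).trace = - (2 * (K.adjugate * L).trace) := by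
    conv_lhs => rw [hK, mul_sub, trace_sub, ← hK, h2]
    ring
  rw [e] at h1
  convert h1 using 1
  · norm_num
  · linear_combination (-1 : R) * h3 + h4

/-- The matrix factors as `B (1 - c tᵀ)`, so no invertibility of `B` is needed. -/
theorem det_sub_vecMulVec_mulVec (B : Matrix ι ι R) (c t : ι → R) :
    (B - vecMulVec (B *ᵥ c) t).det = B.det * (1 - t ⬝ᵥ c) := by
  have e : B - vecMulVec (B *ᵥ c) t = B * (1 + replicateCol Unit c * replicateRow Unit (-t)) := by
    rw [mul_add, mul_one, sub_eq_add_neg, ← vecMulVec_neg, ← vecMulVec_eq, mul_vecMulVec]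
  rw [e, det_mul, det_one_add_replicateCol_mul_replicateRow, neg_dotProduct, sub_eq_add_neg]

/-- If `B` represents `t` by `c`, and `t tᵀ - B = L + Lᵀ`, then `det B` and `det (Lᵀ - L)` agree
modulo `4` as soon as `t ⬝ c` is the (even) size. -/
theorem four_dvd_det_sub_det_antisymm (hm : Even (Fintype.card ι)) {B L : Matrix ι ι R}
    {t c : ι → R} (hB : vecMulVec t t - B = L + Lᵀ) (ht : B *ᵥ c = t)
    (hc : t ⬝ᵥ c = Fintype.card ι) : (4 : R) ∣ B.det - (Lᵀ - L).det := by
  obtain ⟨u, hu⟩ := four_dvd_det_symm_sub hm L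
  have h1 := det_sub_vecMulVec_mulVec B c t
  rw [ht, ← neg_sub, hB, det_neg, hm.neg_one_pow, one_mul, hc] at h1
  obtain ⟨k, hk⟩ := hm
  rw [hk] at h1 hu
  push_cast at h1 hu
  -- Here `1 - 2k` is its own inverse mod 4: `(1 - 2k) ^ 2 = 1 + 4 (k ^ 2 - k)`.
  refine ⟨(1 - (k + k)) * u - (k ^ 2 - k) * (B.det - (Lᵀ - L).det), ?_⟩
  linear_combination (1 - (k + k : R)) * hu - (1 - (k + k : R)) * h1

end DetExpansion

/-! ### Antisymmetric matrices and rank one updates. -/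

section Antisymm

variable {R ι : Type*} [CommRing R] [IsDomain R] [CharZero R] [Fintype ι] [DecidableEq ι]

theorem det_eq_zero_of_antisymm_of_odd (hm : Odd (Fintype.card ι)) {K : Matrix ι ι R}
    (hK : Kᵀ = -K) : K.det = 0 := by
  have h := det_transpose K
  rw [hK, det_neg, hm.neg_one_pow, neg_one_mul] at h
  exact self_eq_neg.1 h.symm

/-- Border `K` by the column `t` and the row `-t`. With corner `1` the Schur complement is `K + t
tᵀ`. Splitting the top row as `(1, 0) + (0, -t)` leaves `det K` plus the determinant of an
antisymmetric matrix of odd size, which vanishes. -/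
theorem det_add_vecMulVec_of_antisymm (hm : Even (Fintype.card ι)) {K : Matrix ι ι R}
    (hK : Kᵀ = -K) (t : ι → R) : (K + vecMulVec t t).det = K.det := by
  have h0 : (fromBlocks 0 (-replicateRow Unit t) (replicateCol Unit t) K).det = 0 := by
    apply det_eq_zero_of_antisymm_of_odd
    · rw [Fintype.card_sum, Fintype.card_unit]
      exact odd_one.add_even hm
    · rw [fromBlocks_transpose, fromBlocks_neg, hK]
      simp
  have h1 : (fromBlocks 1 0 (replicateCol Unit t) K).det = K.det := by
    simp
  have h2 : (fromBlocks 1 (-replicateRow Unit t) (replicateCol Unit t) K).det =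
      (K + vecMulVec t t).det := by
    rw [det_fromBlocks_one₁₁, Matrix.mul_neg, sub_neg_eq_add, ← vecMulVec_eq]
  have e1 : fromBlocks 1 0 (replicateCol Unit t) K =
      (fromBlocks 1 (-replicateRow Unit t) (replicateCol Unit t) K).updateRow (Sum.inl ())
        (Sum.elim 1 0) := by
    ext (i | i) (j | j) <;> simp [updateRow_apply]
  have e0 : fromBlocks 0 (-replicateRow Unit t) (replicateCol Unit t) K =
      (fromBlocks 1 (-replicateRow Unit t) (replicateCol Unit t) K).updateRow (Sum.inl ())
        (Sum.elim 0 (-t)) := by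
    ext (i | i) (j | j) <;> simp [updateRow_apply]
  have e2 : fromBlocks 1 (-replicateRow Unit t) (replicateCol Unit t) K =
      (fromBlocks 1 (-replicateRow Unit t) (replicateCol Unit t) K).updateRow (Sum.inl ())
        ((Sum.elim 1 0 : Unit ⊕ ι → R) + (Sum.elim 0 (-t) : Unit ⊕ ι → R)) := by
    ext (i | i) (j | j) <;> simp [updateRow_apply]
  rw [← h2, e2, det_updateRow_add, ← e1, ← e0, h0, h1, add_zero]

end Antisymm

/-! ### Alternating determinants are squares. -/

section Square

/-- The determinant of an alternating matrix over a field is a square. -/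
theorem isSquare_det_of_alternating_field {F : Type*} [Field F] (m : ℕ) :
    ∀ {ι : Type} [Fintype ι] [DecidableEq ι] (_ : Fintype.card ι = m) (K : Matrix ι ι F)
      (_ : Kᵀ = -K) (_ : ∀ i, K i i = 0), IsSquare K.det := by
  induction m using Nat.strong_induction_on with
  | _ m ih =>
  intro ι _ _ hι K hK hd
  have hK' : ∀ i j, K i j = - K j i := fun i j => by
    have := congr_fun₂ hK j i
    simpa using this
  by_cases hz : ∀ i j, K i j = 0
  · have : K = 0 := by ext i j; exact hz i j
    subst this
    rcases isEmpty_or_nonempty ι with h | h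
    · simp
    · rw [det_zero]; exact IsSquare.zero
  push Not at hz
  obtain ⟨a, b, hab⟩ := hz
  have hne : a ≠ b := fun h => hab (by rw [h, hd])
  -- The nonzero entry `K a b` gives an invertible 2 × 2 pivot block of determinant `K a b ^ 2`; its
  -- Schur complement is again alternating, so the induction applies.
  let p : ι → Prop := fun i => i = a ∨ i = b
  let e := (Equiv.sumCompl p)
  set M := K.submatrix e e with hM
  have hdet : M.det = K.det := det_submatrix_equiv_self e K
  rw [← hdet, ← fromBlocks_toBlocks M]
  let f : Fin 2 ≃ {i // p i} := 
    Equiv.ofBijective ![⟨a, Or.inl rfl⟩, ⟨b, Or.inr rfl⟩] (by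
      constructor
      · intro i j
        fin_cases i <;> fin_cases j <;> simp [hne, hne.symm]
      · rintro ⟨i, rfl | rfl⟩
        · exact ⟨0, rfl⟩
        · exact ⟨1, rfl⟩)
  have hA : M.toBlocks₁₁.det = K a b ^ 2 := by
    rw [← det_submatrix_equiv_self f, det_fin_two]
    have hM11 : ∀ i j, M.toBlocks₁₁ i j = K i j := fun _ _ => rfl
    have f0 : (f 0 : ι) = a := rfl
    have f1 : (f 1 : ι) = b := rfl
    simp only [submatrix_apply, hM11, f0, f1, hd, hK' b a]
    ring
  have hu : IsUnit M.toBlocks₁₁.det := by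
    rw [hA]; exact (pow_ne_zero 2 hab).isUnit
  have : Invertible M.toBlocks₁₁ := invertibleOfIsUnitDet _ hu
  have t11 : M.toBlocks₁₁ᵀ = -M.toBlocks₁₁ := by
    ext i j; exact hK' _ _
  have t22 : M.toBlocks₂₂ᵀ = -M.toBlocks₂₂ := by
    ext i j; exact hK' _ _
  have t12 : M.toBlocks₁₂ᵀ = -M.toBlocks₂₁ := by
    ext i j; exact hK' _ _
  have t21 : M.toBlocks₂₁ᵀ = -M.toBlocks₁₂ := by
    ext i j; exact hK' _ _
  have tinv : (⅟M.toBlocks₁₁)ᵀ = -⅟M.toBlocks₁₁ := by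
    rw [invOf_eq_nonsing_inv, transpose_nonsing_inv, t11]
    exact inv_eq_left_inv (by rw [neg_mul_neg, nonsing_inv_mul _ hu])
  rw [det_fromBlocks₁₁, hA]
  refine IsSquare.mul (IsSquare.sq _) (ih (Fintype.card {i // ¬ p i}) ?_ rfl _ ?_ ?_)
  · rw [← hι]
    exact Fintype.card_subtype_lt (x := a) (by simp [p])
  · rw [transpose_sub, transpose_mul, transpose_mul, t22, tinv, t12, t21]
    simp only [Matrix.neg_mul, Matrix.mul_neg, neg_neg, Matrix.mul_assoc]
    abel
  · intro i
    -- In characteristic two antisymmetry does not force a zero diagonal, so that of the Schur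
    -- complement is checked separately: it is a value of the alternating form of the inverse pivot.
    have hx : ∀ (Q : Matrix {i // p i} {i // p i} F) (_ : Qᵀ = -Q) (_ : ∀ i, Q i i = 0)
        (v : {i // p i} → F), v ⬝ᵥ (Q *ᵥ v) = 0 := by
      intro Q hQ hQd v
      have hQ' : Q (f 1) (f 0) = - Q (f 0) (f 1) := congr_fun₂ hQ (f 0) (f 1)
      simp only [dotProduct, mulVec]
      rw [← f.sum_comp]
      simp only [← f.sum_comp, Fin.sum_univ_two, hQd, hQ']
      ring
    have hinvd : ∀ i, (⅟M.toBlocks₁₁) i i = 0 := by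
      simp only [invOf_eq_nonsing_inv]
      rw [← f.forall_congr_right]
      have h2 : M.toBlocks₁₁⁻¹.submatrix f f = (M.toBlocks₁₁.submatrix f f)⁻¹ :=
        (inv_submatrix_equiv _ f f).symm
      intro i
      rw [show M.toBlocks₁₁⁻¹ (f i) (f i) = M.toBlocks₁₁⁻¹.submatrix f f i i from rfl, h2,
        inv_def, adjugate_fin_two]
      have hdd : ∀ j, M.toBlocks₁₁ j j = 0 := fun j => hd _
      fin_cases i <;> simp [hdd]
    have h3 := hx _ tinv hinvd (fun j => M.toBlocks₁₂ j i)
    have h4 : ∀ j, M.toBlocks₂₁ i j = - M.toBlocks₁₂ j i := fun j => hK' _ _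
    rw [Matrix.sub_apply, Matrix.mul_assoc, mul_apply]
    simp only [h4]
    rw [show M.toBlocks₂₂ i i = 0 from hd _]
    simp only [dotProduct, mulVec, invOf_eq_nonsing_inv] at h3
    simpa [mul_apply] using h3

/-- A square root in the fraction field is integral over `S`, hence lies in `S`. -/
theorem exists_det_eq_sq_of_alternating {S : Type*} [CommRing S] [IsDomain S]
    [IsIntegrallyClosed S] {ι : Type} [Fintype ι] [DecidableEq ι] {K : Matrix ι ι S}
    (hK : Kᵀ = -K) (hd : ∀ i, K i i = 0) : ∃ q, K.det = q ^ 2 := by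
  let φ := algebraMap S (FractionRing S)
  obtain ⟨y, hy⟩ := isSquare_det_of_alternating_field _ rfl (φ.mapMatrix K)
    (by ext i j; simpa using congr_arg φ (congr_fun₂ hK i j)) (by intro i; simp [hd])
  rw [← RingHom.map_det, ← sq] at hy
  obtain ⟨q, hq⟩ := IsIntegrallyClosed.exists_algebraMap_eq_of_isIntegral_pow (R := S) (x := y)
    two_pos (by rw [← hy]; exact isIntegral_algebraMap)
  refine ⟨q, IsFractionRing.injective S (FractionRing S) ?_⟩
  rw [map_pow, hq, ← hy]

end Square

end DiscPfaffian

namespace DiscPfaffian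

/-! ### Perfect matchings as involutions. -/

section Involutions

variable {m : ℕ}

/-- The nontrivial orbits of an involution. -/
def orbitMatching (σ : Equiv.Perm (Fin m)) (h : ∀ x, σ (σ x) = x) : Finpartition σ.support where
  parts := σ.support.image fun x => {x, σ x}
  supIndep := by
    rw [Finset.supIndep_iff_pairwiseDisjoint]
    intro p hp q hq hpq
    simp only [Finset.coe_image, Set.mem_image] at hp hq
    obtain ⟨x, -, rfl⟩ := hp
    obtain ⟨y, -, rfl⟩ := hq
    simp only [Function.onFun, id, Finset.disjoint_left, Finset.mem_insert, Finset.mem_singleton]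
    have hx := h x
    have hy := h y
    rintro a (rfl | rfl) (hay | hay)
    · exact hpq (by rw [hay])
    · apply hpq; rw [hay, hy, Finset.pair_comm]
    · apply hpq; rw [← hay, hx, Finset.pair_comm]
    · apply hpq; rw [σ.injective hay]
  sup_parts := by
    ext a
    simp only [Finset.mem_sup, Finset.mem_image, id]
    constructor
    · rintro ⟨_, ⟨x, hx, rfl⟩, ha⟩
      rcases Finset.mem_insert.1 ha with rfl | ha
      · exact hx
      · rw [Finset.mem_singleton.1 ha]
        exact Equiv.Perm.apply_mem_support.2 hx
    · intro ha
      exact ⟨_, ⟨a, ha, rfl⟩, by simp⟩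
  bot_notMem := by
    simp only [Finset.bot_eq_empty, Finset.mem_image, not_exists, not_and]
    exact fun x _ => Finset.insert_ne_empty _ _

theorem orbitMatching_mem (σ : Equiv.Perm (Fin m)) (h : ∀ x, σ (σ x) = x) :
    orbitMatching σ h ∈ perfectMatchings σ.support := by
  simp only [perfectMatchings, Finset.mem_filter, Finset.mem_univ, true_and]
  intro p hp
  obtain ⟨x, hx, rfl⟩ := Finset.mem_image.1 hp
  exact Finset.card_pair (Equiv.Perm.mem_support.1 hx).symm

theorem even_card_of_mem_perfectMatchings {J : Finset (Fin m)} {P : Finpartition J}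
    (hP : P ∈ perfectMatchings J) : Even J.card := by
  rw [← P.sum_card_parts]
  exact Finset.even_sum _ fun p hp => by
    rw [(Finset.mem_filter.1 hP).2 p hp]
    exact even_two

theorem sigma_finpartition_ext {a b : Σ J : Finset (Fin m), Finpartition J} (h : a.1 = b.1)
    (h' : a.2.parts = b.2.parts) : a = b := by
  obtain ⟨J, P⟩ := a
  obtain ⟨J', P'⟩ := b
  obtain rfl : J = J' := h
  obtain rfl : P = P' := Finpartition.ext h'
  rfl

theorem orbitMatching_injective {σ τ : Equiv.Perm (Fin m)} (hσ : ∀ x, σ (σ x) = x)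
    (hτ : ∀ x, τ (τ x) = x) (hs : σ.support = τ.support)
    (h : (orbitMatching σ hσ).parts = (orbitMatching τ hτ).parts) : σ = τ := by
  ext1 x
  by_cases hx : x ∈ σ.support
  · have h1 : ({x, σ x} : Finset (Fin m)) ∈ (orbitMatching τ hτ).parts := by
      rw [← h]
      exact Finset.mem_image_of_mem _ hx
    have h2 : ({x, τ x} : Finset (Fin m)) ∈ (orbitMatching τ hτ).parts :=
      Finset.mem_image_of_mem (fun x => {x, τ x}) (hs ▸ hx)
    have h3 := (orbitMatching τ hτ).eq_of_mem_parts h1 h2 (a := x) (by simp) (by simp)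
    have h4 : σ x ∈ ({x, τ x} : Finset (Fin m)) := by rw [← h3]; simp
    simpa [Equiv.Perm.mem_support.1 hx] using h4
  · have hx' := hs ▸ hx
    rw [Equiv.Perm.notMem_support.1 hx, Equiv.Perm.notMem_support.1 hx']

theorem exists_orbitMatching {J : Finset (Fin m)} {P : Finpartition J}
    (hP : P ∈ perfectMatchings J) : ∃ (σ : Equiv.Perm (Fin m)) (h : ∀ x, σ (σ x) = x),
      σ.support = J ∧ (orbitMatching σ h).parts = P.parts := by
  have hP' := (Finset.mem_filter.1 hP).2
  -- The involution swaps the two elements of each part and fixes everything outside `J`.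
  have hex : ∀ x, ∃ y, (x ∈ J → P.part x = {x, y} ∧ y ≠ x) ∧ (x ∉ J → y = x) := by
    intro x
    by_cases hx : x ∈ J
    · obtain ⟨a, b, hab, he⟩ := Finset.card_eq_two.1 (hP' _ (P.part_mem.2 hx))
      have hmem := P.mem_part_self.2 hx
      rw [he, Finset.mem_insert, Finset.mem_singleton] at hmem
      rcases hmem with rfl | rfl
      · exact ⟨b, fun _ => ⟨he, hab.symm⟩, fun h => absurd hx h⟩
      · exact ⟨a, fun _ => ⟨by rw [he, Finset.pair_comm], hab⟩, fun h => absurd hx h⟩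
    · exact ⟨x, fun h => absurd h hx, fun _ => rfl⟩
  choose f hf hf' using hex
  have hfJ : ∀ x ∈ J, f x ∈ J := fun x hx =>
    P.part_subset x (by rw [(hf x hx).1]; simp)
  have hff : Function.Involutive f := by
    intro x
    by_cases hx : x ∈ J
    · have h1 : P.part (f x) = P.part x :=
        P.part_eq_of_mem (P.part_mem.2 hx) (by rw [(hf x hx).1]; simp)
      have h2 : f (f x) ∈ ({x, f x} : Finset (Fin m)) := by
        rw [← (hf x hx).1, ← h1, (hf _ (hfJ x hx)).1]; simp
      simpa [(hf _ (hfJ x hx)).2] using h2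
    · rw [hf' x hx, hf' x hx]
  have hsupp : (hff.toPerm f).support = J := by
    ext x
    rw [Equiv.Perm.mem_support, Function.Involutive.coe_toPerm]
    by_cases hx : x ∈ J
    · simp [hx, (hf x hx).2]
    · simp [hx, hf' x hx]
  refine ⟨hff.toPerm f, hff, hsupp, ?_⟩
  ext p
  simp only [orbitMatching, hsupp, Finset.mem_image, Function.Involutive.coe_toPerm]
  constructor
  · rintro ⟨x, hx, rfl⟩
    rw [← (hf x hx).1]
    exact P.part_mem.2 hx
  · intro hp
    obtain ⟨x, hx⟩ := P.nonempty_of_mem_parts hp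
    have hxJ := P.subset hp hx
    exact ⟨x, hxJ, by rw [← (hf x hxJ).1, P.part_eq_of_mem hp hx]⟩

theorem filter_lt_offDiag_pair {a b : Fin m} (h : a < b) :
    (({a, b} : Finset (Fin m)).offDiag.filter fun x => x.1 < x.2) = {(a, b)} := by
  ext ⟨x, y⟩
  simp only [Finset.mem_filter, Finset.mem_offDiag, Finset.mem_insert, Finset.mem_singleton,
    Prod.mk.injEq]
  constructor
  · rintro ⟨⟨rfl | rfl, rfl | rfl, h1⟩, h2⟩
    · exact absurd rfl h1
    · exact ⟨rfl, rfl⟩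
    · exact absurd h2 h.not_gt
    · exact absurd rfl h1
  · rintro ⟨rfl, rfl⟩
    exact ⟨⟨Or.inl rfl, Or.inr rfl, h.ne⟩, h⟩

/-- A transposition `(a b)` contributes `B b a * B a b`, the square of the one factor attached to
the part `{a, b}`. -/
theorem sq_prod_orbitMatching {R : Type*} [CommRing R] (B : Matrix (Fin m) (Fin m) R)
    (hB : ∀ i j, B i j = B j i) (σ : Equiv.Perm (Fin m)) (h : ∀ x, σ (σ x) = x) :
    (∏ p ∈ (orbitMatching σ h).parts, ∏ x ∈ p.offDiag with x.1 < x.2, B x.1 x.2) ^ 2 =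
      ∏ i ∈ σ.support, B (σ i) i := by
  have h1 : ∏ i ∈ σ.support, B (σ i) i =
      ∏ p ∈ (orbitMatching σ h).parts, ∏ i ∈ p, B (σ i) i := by
    conv_lhs => rw [← (orbitMatching σ h).biUnion_parts]
    exact Finset.prod_biUnion (orbitMatching σ h).disjoint
  rw [h1, ← Finset.prod_pow]
  refine Finset.prod_congr rfl fun p hp => ?_
  obtain ⟨x, hx, rfl⟩ := Finset.mem_image.1 hp
  have hne := Equiv.Perm.mem_support.1 hx
  have key : ∀ a b : Fin m, a < b → σ a = b → σ b = a →
      (∏ x ∈ ({a, b} : Finset (Fin m)).offDiag with x.1 < x.2, B x.1 x.2) ^ 2 =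
        ∏ i ∈ ({a, b} : Finset (Fin m)), B (σ i) i := by
    intro a b hab ha hb
    rw [filter_lt_offDiag_pair hab, Finset.prod_singleton, Finset.prod_pair hab.ne, ha, hb,
      hB b a, sq]
  rcases hne.lt_or_gt with hlt | hlt
  · have := key _ _ hlt (h x) rfl
    rwa [Finset.pair_comm] at this
  · exact key _ _ hlt rfl (h x)

end Involutions

/-! ### The discriminant pfaffian in characteristic two. -/

section CharTwo

variable {R : Type*} [CommRing R] [CharP R 2]

/-- In characteristic two only the involutions contribute to the determinant of a symmetric
matrix. -/
theorem det_eq_sum_involutions {m : ℕ} (M : Matrix (Fin m) (Fin m) R)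
    (hM : ∀ i j, M i j = M j i) :
    M.det = ∑ σ : Equiv.Perm (Fin m) with ∀ x, σ (σ x) = x, ∏ i, M (σ i) i := by
  have h0 : M.det = ∑ σ : Equiv.Perm (Fin m), ∏ i, M (σ i) i := by
    rw [Matrix.det_apply]
    refine Finset.sum_congr rfl fun σ _ => ?_
    rcases Int.units_eq_one_or (Equiv.Perm.sign σ) with h | h <;> rw [h] <;> simp [CharTwo.neg_eq]
  rw [h0, ← Finset.sum_filter_add_sum_filter_not _ (fun σ : Equiv.Perm (Fin m) => ∀ x, σ (σ x) = x)]
  have hinv : ∀ σ : Equiv.Perm (Fin m), ∏ i, M (σ⁻¹ i) i = ∏ i, M (σ i) i := by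
    intro σ
    rw [← Equiv.prod_comp σ]
    refine Finset.prod_congr rfl fun i _ => ?_
    rw [Equiv.Perm.inv_def, Equiv.symm_apply_apply, hM]
  have hiff : ∀ σ : Equiv.Perm (Fin m), σ⁻¹ = σ ↔ ∀ x, σ (σ x) = x := by
    intro σ
    rw [Equiv.ext_iff]
    exact forall_congr' fun x => by rw [Equiv.Perm.inv_eq_iff_eq, eq_comm]
  rw [add_eq_left]
  -- By symmetry `σ` and `σ⁻¹` have equal terms, so the non-involutions cancel in pairs.
  refine Finset.sum_involution (fun σ _ => σ⁻¹) ?_ ?_ ?_ ?_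
  · intro σ _
    rw [hinv, CharTwo.add_self_eq_zero]
  · intro σ hσ _ he
    exact (Finset.mem_filter.1 hσ).2 ((hiff σ).1 he)
  · intro σ hσ
    rw [Finset.mem_filter, ← hiff] at hσ ⊢
    rw [inv_inv]
    exact ⟨Finset.mem_univ _, fun h => hσ.2 h.symm⟩
  · intro σ _
    exact inv_inv σ

/-- In characteristic two the square of the discriminant pfaffian is a determinant. -/
theorem matrixDpf_sq {m : ℕ} (B : Matrix (Fin (m + 1)) (Fin (m + 1)) R)
    (hs : ∀ i j, B i j = B j i) (hd : ∀ i, i ≠ 0 → B i i = B 0 i ^ 2) :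
    matrixDpf B ^ 2 = (B.submatrix Fin.succ Fin.succ).det := by
  -- Keeping index `0` as a trivial block leaves the determinant unchanged and kills the
  -- permutations moving `0`, matching the sets `J` that avoid `0`.
  set M : Matrix (Fin (m + 1)) (Fin (m + 1)) R := Matrix.of fun i j =>
    if i = 0 then (if j = 0 then 1 else 0) else if j = 0 then 0 else B i j with hM
  have hdet : M.det = (B.submatrix Fin.succ Fin.succ).det := by
    rw [Matrix.det_succ_row_zero, Fin.sum_univ_succ, Finset.sum_eq_zero]
    · have : M.submatrix Fin.succ (Fin.succAbove 0) = B.submatrix Fin.succ Fin.succ := by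
        ext i j
        simp [hM]
      rw [this]
      simp [hM]
    · intro i _
      simp [hM]
  have hMs : ∀ i j, M i j = M j i := by
    intro i j
    by_cases hi : i = 0 <;> by_cases hj : j = 0 <;> simp [hM, hi, hj, hs i j]
  rw [← hdet, det_eq_sum_involutions M hMs]
  have hfix : (∑ σ : Equiv.Perm (Fin (m + 1)) with ∀ x, σ (σ x) = x, ∏ i, M (σ i) i) =
      ∑ σ : Equiv.Perm (Fin (m + 1)) with (∀ x, σ (σ x) = x) ∧ σ 0 = 0, ∏ i, M (σ i) i := by
    symm
    apply Finset.sum_subset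
    · intro σ hσ
      simp only [Finset.mem_filter, Finset.mem_univ, true_and] at hσ ⊢
      exact hσ.1
    · intro σ hσ hσ'
      simp only [Finset.mem_filter, Finset.mem_univ, true_and] at hσ hσ'
      refine Finset.prod_eq_zero (Finset.mem_univ 0) ?_
      have : σ 0 ≠ 0 := fun h => hσ' ⟨hσ, h⟩
      simp [hM, this]
  rw [hfix, matrixDpf, CharTwo.sum_sq]
  simp only [CharTwo.sum_sq]
  rw [Finset.sum_sigma']
  symm
  refine Finset.sum_bij (fun σ hσ => ⟨σ.support, orbitMatching σ (Finset.mem_filter.1 hσ).2.1⟩)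
    ?_ ?_ ?_ ?_
  · intro σ hσ
    simp only [Finset.mem_sigma, Finset.mem_filter, Finset.mem_powerset]
    have hm := orbitMatching_mem σ (Finset.mem_filter.1 hσ).2.1
    refine ⟨⟨?_, even_card_of_mem_perfectMatchings hm⟩, hm⟩
    intro x hx
    rw [Finset.mem_erase]
    refine ⟨?_, Finset.mem_univ _⟩
    rintro rfl
    exact Equiv.Perm.mem_support.1 hx (Finset.mem_filter.1 hσ).2.2
  · intro σ hσ τ hτ h
    have h1 : σ.support = τ.support := congr_arg Sigma.fst h
    have h2 := congr_arg (fun a : Σ J : Finset (Fin (m + 1)), Finpartition J => a.2.parts) h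
    exact orbitMatching_injective (Finset.mem_filter.1 hσ).2.1 (Finset.mem_filter.1 hτ).2.1 h1 h2
  · rintro ⟨J, P⟩ hJP
    simp only [Finset.mem_sigma, Finset.mem_filter, Finset.mem_powerset] at hJP
    obtain ⟨σ, h, hJ, hP⟩ := exists_orbitMatching hJP.2
    refine ⟨σ, ?_, sigma_finpartition_ext hJ hP⟩
    rw [Finset.mem_filter]
    refine ⟨Finset.mem_univ _, h, ?_⟩
    rw [← Equiv.Perm.notMem_support, hJ]
    intro h0
    simpa using hJP.1.1 h0
  · intro σ hσ
    obtain ⟨-, h, h0⟩ := Finset.mem_filter.1 hσ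
    rw [mul_pow, sq_prod_orbitMatching B hs, ← Finset.prod_mul_prod_compl σ.support]
    have h0s : (0 : Fin (m + 1)) ∉ σ.support := Equiv.Perm.notMem_support.2 h0
    congr 1
    · refine Finset.prod_congr rfl fun i hi => ?_
      have hi0 : i ≠ 0 := fun h => h0s (h ▸ hi)
      have hi1 : σ i ≠ 0 := fun h => hi0 (σ.injective (h.trans h0.symm))
      simp [hM, hi0, hi1]
    -- The fixed points are `0`, contributing `1`, and the `k` outside `J`, contributing `B k k = B
    -- 0 k ^ 2`.
    · have he : σ.supportᶜ = insert 0 (Finset.univ.erase 0 \ σ.support) := by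
        ext i
        by_cases hi : i = 0
        · simpa [hi] using h0
        · simp [hi]
      rw [he, Finset.prod_insert (by simp), ← Finset.prod_pow,
        show M (σ 0) 0 = 1 by simp [hM, h0], one_mul]
      refine Finset.prod_congr rfl fun i hi => ?_
      simp only [Finset.mem_sdiff, Finset.mem_erase] at hi
      rw [Equiv.Perm.notMem_support.1 hi.2, ← hd i hi.1.1]
      simp [hM, hi.1.1]

end CharTwo

end DiscPfaffian

/-! ### Comparison of the two square roots, generically and then over `R`. -/

namespace DiscPfaffian

open Matrix

/-- The symmetric matrix `B`, bordered by the vector `t`. -/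
def bordered {R : Type*} [CommRing R] {n : ℕ} (t : Fin n → R) (B : Matrix (Fin n) (Fin n) R) :
    Matrix (Fin (n + 1)) (Fin (n + 1)) R :=
  Matrix.of (Fin.cons (Fin.cons ((n : R) + 1) t) fun i => Fin.cons (t i) (B i))

section Bordered

variable {R S : Type*} [CommRing R] [CommRing S] {n : ℕ}

@[simp] theorem bordered_zero_zero (t : Fin n → R) (B : Matrix (Fin n) (Fin n) R) :
    bordered t B 0 0 = n + 1 := rfl

@[simp] theorem bordered_zero_succ (t : Fin n → R) (B : Matrix (Fin n) (Fin n) R) (j : Fin n) :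
    bordered t B 0 j.succ = t j := rfl

@[simp] theorem bordered_succ_zero (t : Fin n → R) (B : Matrix (Fin n) (Fin n) R) (i : Fin n) :
    bordered t B i.succ 0 = t i := rfl

@[simp] theorem bordered_succ_succ (t : Fin n → R) (B : Matrix (Fin n) (Fin n) R) (i j : Fin n) :
    bordered t B i.succ j.succ = B i j := rfl

theorem bordered_map (f : S →+* R) (t : Fin n → S) (B : Matrix (Fin n) (Fin n) S) :
    (bordered t B).map f = bordered (f ∘ t) (B.map f) := by
  ext i j
  refine Fin.cases ?_ (fun i => ?_) i <;> refine Fin.cases ?_ (fun j => ?_) j <;> simp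

theorem matrixDpf_map (f : S →+* R) (B : Matrix (Fin (n + 1)) (Fin (n + 1)) S) :
    matrixDpf (B.map f) = f (matrixDpf B) := by
  simp [matrixDpf, map_sum, map_prod]

theorem matrixDpf_bordered_sq [CharP R 2] {t : Fin n → R} {B : Matrix (Fin n) (Fin n) R}
    (hs : ∀ i j, B i j = B j i) (hd : ∀ i, B i i = t i ^ 2) :
    matrixDpf (bordered t B) ^ 2 = B.det := by
  rw [matrixDpf_sq]
  · rfl
  · intro i j
    refine Fin.cases ?_ (fun i => ?_) i <;> refine Fin.cases ?_ (fun j => ?_) j <;> simp [hs]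
  · intro i hi
    obtain ⟨i, rfl⟩ := Fin.exists_succ_eq.2 hi
    simpa using hd i

end Bordered

/-- Both `q` and the discriminant pfaffian square to the same determinant mod 2, and `MvPolynomial σ
(ZMod 2)` is a domain of characteristic two. The separate data `u`, `M` allow for the enlarged
matrix when `n` is odd. -/
theorem exists_matrixDpf_eq_add_two_mul {σ : Type*} {n : ℕ} {ι : Type} [Fintype ι] [DecidableEq ι]
    (hι : Even (Fintype.card ι)) (t : Fin n → MvPolynomial σ ℤ)
    (L : Matrix (Fin n) (Fin n) (MvPolynomial σ ℤ)) (u : ι → MvPolynomial σ ℤ)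
    (M : Matrix ι ι (MvPolynomial σ ℤ))
    (h : (vecMulVec u u - (M + Mᵀ)).det = (vecMulVec t t - (L + Lᵀ)).det) :
    ∃ q r, (Mᵀ - M).det = q ^ 2 ∧
      matrixDpf (bordered t (vecMulVec t t - (L + Lᵀ))) = q + 2 * r := by
  have hK : (Mᵀ - M)ᵀ = -(Mᵀ - M) := by simp
  obtain ⟨q, hq⟩ := exists_det_eq_sq_of_alternating hK (by simp)
  let φ := MvPolynomial.map (σ := σ) (Int.castRingHom (ZMod 2))
  have hφ2 : φ 2 = 0 := by
    rw [map_ofNat]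
    exact CharTwo.two_eq_zero
  have h1 : (2 : MvPolynomial σ ℤ) ∣
      (Mᵀ - M + vecMulVec u u).det - (vecMulVec u u - (M + Mᵀ)).det := by
    refine dvd_det_sub_det fun i j => ⟨M j i, ?_⟩
    simp only [Matrix.add_apply, Matrix.sub_apply, transpose_apply]
    ring
  rw [det_add_vecMulVec_of_antisymm hι hK, h, hq] at h1
  have h2 : φ (matrixDpf (bordered t (vecMulVec t t - (L + Lᵀ)))) ^ 2 = φ q ^ 2 := by
    rw [← matrixDpf_map, bordered_map, matrixDpf_bordered_sq]
    · obtain ⟨v, hv⟩ := h1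
      have h3 := congr_arg φ hv
      rw [map_mul, hφ2, zero_mul, map_sub, sub_eq_zero, RingHom.map_det] at h3
      rw [← map_pow, h3]
      rfl
    · intro i j
      simp only [map_apply, Matrix.sub_apply, Matrix.add_apply, vecMulVec_apply, transpose_apply]
      congr 1
      ring
    · intro i
      simp only [map_apply, Matrix.sub_apply, Matrix.add_apply, vecMulVec_apply, transpose_apply,
        Function.comp]
      rw [← two_mul, map_sub, map_mul φ 2, hφ2, map_mul]
      ring
  have h4 : φ (matrixDpf (bordered t (vecMulVec t t - (L + Lᵀ))) - q) = 0 := by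
    rw [map_sub]
    refine pow_eq_zero_iff two_ne_zero |>.1 ?_
    linear_combination h2 + (φ q ^ 2 - φ (matrixDpf (bordered t (vecMulVec t t - (L + Lᵀ)))) * φ q) *
      CharTwo.two_eq_zero (R := MvPolynomial σ (ZMod 2))
  obtain ⟨r, hr⟩ := (MvPolynomial.C_dvd_iff_zmod 2 _).2 h4
  refine ⟨q, r, hq, ?_⟩
  rw [sub_eq_iff_eq_add'] at hr
  rw [hr]
  simp

section Extend

variable {R S : Type*} [CommRing R] [CommRing S] {n : ℕ}

/-- `L` enlarged by one index, so that `u uᵀ - (M + Mᵀ)`, with `u = (1, t)` and `M` the enlarged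
matrix, is the direct sum of `1` and `t tᵀ - (L + Lᵀ)`. -/
def extend (t : Fin n → R) (L : Matrix (Fin n) (Fin n) R) :
    Matrix (Unit ⊕ Fin n) (Unit ⊕ Fin n) R :=
  fromBlocks 0 (replicateRow Unit t) 0 L

theorem extend_map (f : S →+* R) (t : Fin n → S) (L : Matrix (Fin n) (Fin n) S) :
    (extend t L).map f = extend (f ∘ t) (L.map f) := by
  ext (i | i) (j | j) <;> simp [extend]

theorem vecMulVec_sub_extend (t : Fin n → R) (L : Matrix (Fin n) (Fin n) R) :
    vecMulVec (Sum.elim (1 : Unit → R) t) (Sum.elim (1 : Unit → R) t) -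
        (extend t L + (extend t L)ᵀ) =
      fromBlocks 1 0 0 (vecMulVec t t - (L + Lᵀ)) := by
  ext (i | i) (j | j) <;> simp [extend, vecMulVec_apply]

end Extend

section Main

variable {R : Type*} [CommRing R] {n : ℕ}

theorem four_dvd_sq_sub_sq {p q r : R} (h : p = q + 2 * r) : 4 ∣ q ^ 2 - p ^ 2 :=
  ⟨-(q * r + r ^ 2), by rw [h]; ring⟩

/-- Reduction to indeterminate entries over `ℤ`, where square roots of determinants exist and
squares can be cancelled mod 2. -/
theorem exists_generic (t : Fin n → R) (L : Matrix (Fin n) (Fin n) R) :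
    ∃ (f : MvPolynomial ((Fin n × Fin n) ⊕ Fin n) ℤ →+* R) (t' : Fin n → _)
      (L' : Matrix (Fin n) (Fin n) _), f ∘ t' = t ∧ L'.map f = L := by
  refine ⟨MvPolynomial.eval₂Hom (Int.castRingHom R) (Sum.elim (fun p => L p.1 p.2) t),
    fun i => MvPolynomial.X (Sum.inr i), Matrix.of fun i j => MvPolynomial.X (Sum.inl (i, j)),
    ?_, ?_⟩
  · ext i; simp
  · ext i j; simp

theorem map_vecMulVec_sub {S : Type*} [CommRing S] (f : S →+* R) (t : Fin n → S)
    (L : Matrix (Fin n) (Fin n) S) :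
    (vecMulVec t t - (L + Lᵀ)).map f = vecMulVec (f ∘ t) (f ∘ t) - (L.map f + (L.map f)ᵀ) := by
  ext i j
  simp [vecMulVec_apply]

theorem four_dvd_det_antisymm_sub_matrixDpf_sq (hn : Even n) (t : Fin n → R)
    (L : Matrix (Fin n) (Fin n) R) :
    4 ∣ (Lᵀ - L).det - matrixDpf (bordered t (vecMulVec t t - (L + Lᵀ))) ^ 2 := by
  obtain ⟨f, t, L, rfl, rfl⟩ := exists_generic t L
  obtain ⟨q, r, hq, hr⟩ := exists_matrixDpf_eq_add_two_mul (by simpa using hn) t L t L rfl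
  have := map_dvd f (four_dvd_sq_sub_sq hr)
  rw [← hq, map_sub, map_pow, ← matrixDpf_map, bordered_map, map_vecMulVec_sub, RingHom.map_det,
    map_ofNat] at this
  convert this using 3
  ext i j
  simp

theorem four_dvd_det_extend_sub_matrixDpf_sq (hn : Odd n) (t : Fin n → R)
    (L : Matrix (Fin n) (Fin n) R) :
    4 ∣ ((extend t L)ᵀ - extend t L).det -
      matrixDpf (bordered t (vecMulVec t t - (L + Lᵀ))) ^ 2 := by
  obtain ⟨f, t, L, rfl, rfl⟩ := exists_generic t L
  obtain ⟨q, r, hq, hr⟩ := exists_matrixDpf_eq_add_two_mul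
    (ι := Unit ⊕ Fin n) (by simpa using odd_one.add_odd hn) t L (Sum.elim 1 t) (extend t L)
    (by rw [vecMulVec_sub_extend]; simp)
  have := map_dvd f (four_dvd_sq_sub_sq hr)
  rw [← hq, map_sub, map_pow, ← matrixDpf_map, bordered_map, map_vecMulVec_sub, RingHom.map_det,
    map_ofNat] at this
  convert this using 3
  rw [← extend_map]
  ext i j
  simp

/-- Take the strict lower triangle together with half the diagonal. -/
theorem exists_eq_add_transpose {ι : Type*} [LinearOrder ι] {C : Matrix ι ι R}
    (hC : ∀ i j, C i j = C j i) (hd : ∀ i, ∃ s, C i i = 2 * s) : ∃ L, C = L + Lᵀ := by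
  choose s hs using hd
  refine ⟨Matrix.of fun i j => if j < i then C i j else if i = j then s i else 0, ?_⟩
  ext i j
  rcases lt_trichotomy i j with h | rfl | h
  · simp [h, h.not_gt, h.ne, hC i j]
  · simp [hs, two_mul]
  · simp [h, h.not_gt, h.ne]

/-- If `t = B c` and `t ⬝ c` is the size of the symmetric matrix `B`, and if `t tᵀ - B` has an
even diagonal, then `det B` is congruent modulo `4` to the square of the discriminant pfaffian. -/
theorem four_dvd_det_sub_matrixDpf_sq {B : Matrix (Fin n) (Fin n) R} {t c : Fin n → R}
    (hs : ∀ i j, B i j = B j i) (hd : ∀ i, ∃ s, t i ^ 2 - B i i = 2 * s) (ht : B *ᵥ c = t)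
    (hc : t ⬝ᵥ c = n) : 4 ∣ B.det - matrixDpf (bordered t B) ^ 2 := by
  obtain ⟨L, hL⟩ := exists_eq_add_transpose (C := vecMulVec t t - B)
    (fun i j => by simp [vecMulVec_apply, hs i j, mul_comm])
    (fun i => by simpa [vecMulVec_apply, sq] using hd i)
  have hB : B = vecMulVec t t - (L + Lᵀ) := by rw [← hL, sub_sub_cancel]
  rcases Nat.even_or_odd n with hn | hn
  · have h1 := four_dvd_det_sub_det_antisymm (by simpa using hn) hL ht (by simpa using hc)
    have h2 := four_dvd_det_antisymm_sub_matrixDpf_sq hn t L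
    rw [← hB] at h2
    simpa using dvd_add h1 h2
  · have hB' := vecMulVec_sub_extend t L
    rw [← hB] at hB'
    have h1 := four_dvd_det_sub_det_antisymm (ι := Unit ⊕ Fin n)
      (B := fromBlocks 1 0 0 B) (t := Sum.elim 1 t) (c := Sum.elim 1 c)
      (by simpa using odd_one.add_odd hn) (by rw [← hB', sub_sub_cancel])
      (by rw [fromBlocks_mulVec]; simp [ht])
      (by simp [hc])
    have h2 := four_dvd_det_extend_sub_matrixDpf_sq hn t L
    rw [← hB] at h2
    have h3 : (fromBlocks (1 : Matrix Unit Unit R) 0 0 B).det = B.det := by simp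
    rw [h3] at h1
    simpa using dvd_add h1 h2

end Main

end DiscPfaffian

/-! ### Trace forms of algebras. -/

namespace DiscPfaffian

open Module

/-- The difference is the sum over all `i`, `j` of the 2 × 2 principal minors, symmetric in `i`, `j`
and zero for `i = j`. -/
theorem exists_trace_sq_sub {R ι : Type*} [CommRing R] [Fintype ι] [LinearOrder ι]
    (M : Matrix ι ι R) : ∃ s, M.trace ^ 2 - (M * M).trace = 2 * s := by
  obtain ⟨L, hL⟩ := exists_eq_add_transpose
    (C := Matrix.of fun i j => M i i * M j j - M i j * M j i)
    (fun i j => by simp [mul_comm]) (fun i => ⟨0, by simp⟩)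
  refine ⟨∑ i, ∑ j, L i j, ?_⟩
  have h1 : M.trace ^ 2 - (M * M).trace = ∑ i, ∑ j, (M i i * M j j - M i j * M j i) := by
    simp only [Matrix.trace, Matrix.diag, Matrix.mul_apply, sq, Finset.sum_mul_sum,
      Finset.sum_sub_distrib]
  have h2 : ∀ i j, M i i * M j j - M i j * M j i = L i j + L j i := fun i j => congr_fun₂ hL i j
  simp only [h1, h2, Finset.sum_add_distrib]
  rw [Finset.sum_comm (f := fun i j => L j i), two_mul]

variable {R A : Type*} [CommRing R] [Ring A] [Algebra R A] {n : ℕ}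

theorem trace_leftMulMatrix (β : Basis (Fin n) R A) (a : A) :
    (Algebra.leftMulMatrix β a).trace = LinearMap.trace R A (Algebra.lmul R A a) := by
  rw [LinearMap.trace_eq_matrix_trace R β]
  rfl

theorem trace_leftMulMatrix_unitalFraming (β : Basis (Fin n) R A) (x : R × A) :
    (Algebra.leftMulMatrix (unitalFraming β) x).trace =
      x.1 + (Algebra.leftMulMatrix β x.2).trace := by
  have := Module.Free.of_basis β
  have := Module.Finite.of_basis β
  have h : Algebra.lmul R (R × A) x =
      LinearMap.prodMap (Algebra.lmul R R x.1) (Algebra.lmul R A x.2) := by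
    ext <;> simp
  rw [trace_leftMulMatrix, trace_leftMulMatrix, h, LinearMap.trace_prodMap',
    ← Algebra.trace_apply, Algebra.trace_self_apply]

theorem gram_unitalFraming (β : Basis (Fin n) R A) :
    gram (unitalFraming β) =
      bordered (fun i => (Algebra.leftMulMatrix β (β i)).trace) (gram β) := by
  ext i j
  simp only [gram, Matrix.of_apply, tracePairing, trace_leftMulMatrix_unitalFraming,
    coe_unitalFraming]
  refine Fin.cases ?_ (fun i => ?_) i <;> refine Fin.cases ?_ (fun j => ?_) j
  · simp [Matrix.trace_one, add_comm]
  · simp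
  · simp
  · simp

theorem four_dvd_disc_sub_dpf_sq (β : Basis (Fin n) R A) :
    4 ∣ disc β - dpf (unitalFraming β) ^ 2 := by
  rw [disc, dpf, gram_unitalFraming]
  have hsum : ∑ i, β.equivFun 1 i • β i = 1 := β.sum_equivFun 1
  refine four_dvd_det_sub_matrixDpf_sq (c := β.equivFun 1) ?_ ?_ ?_ ?_
  · intro i j
    simp only [gram, tracePairing, Matrix.of_apply, map_mul]
    exact Matrix.trace_mul_comm _ _
  · intro i
    simpa only [gram, tracePairing, Matrix.of_apply, map_mul] using exists_trace_sq_sub _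
  -- `B c = t` is the trace of `e_i * 1 = e_i`, with `1` expanded in the basis.
  · ext i
    have h : ∑ j, β.equivFun 1 j • (β i * β j) = β i := by
      conv_rhs => rw [← mul_one (β i), ← hsum, Finset.mul_sum]
      simp only [mul_smul_comm]
    conv_rhs => rw [← h]
    simp only [map_sum, map_smul, Matrix.trace_sum, Matrix.trace_smul, smul_eq_mul, gram,
      tracePairing, Matrix.mulVec, dotProduct, Matrix.of_apply, mul_comm]
  -- `t ⬝ c` is the trace of multiplication by `1`.
  · have h : (Algebra.leftMulMatrix β 1).trace = n := by simp [Matrix.trace_one]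
    rw [← h]
    conv_rhs => rw [← hsum]
    simp only [map_sum, map_smul, Matrix.trace_sum, Matrix.trace_smul, smul_eq_mul,
      dotProduct, mul_comm]

end DiscPfaffian

theorem theorem3p11 {R A : Type*} [CommRing R] [Ring A] [Algebra R A] {n : ℕ}
    (β : Module.Basis (Fin n) R A) :
    DiscPfaffian.disc β ≡ DiscPfaffian.dpf (DiscPfaffian.unitalFraming β) ^ 2
      [SMOD (Ideal.span {(4 : R)})] := by
  rw [SModEq.sub_mem, Ideal.mem_span_singleton]
  exact DiscPfaffian.four_dvd_disc_sub_dpf_sq β
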